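/- Let $d\ge 1$, let $(\Omega,\mathfrak F,P)$ be a probability space and let $\mathbb N=\{0,1,2,\dots\}$. Order $\mathbb N^d$ coordinatewise, let $\mathbf n\wedge\mathbf k$ be the coordinatewise minimum, $\mathbf 1=(1,\dots,1)$, $|\mathbf n|=n_1\cdots n_d$. Let $(\mathfrak F_{\mathbf n})_{\mathbf n\in\mathbb N^d}$ be sub-$\sigma$-algebras of $\mathfrak F$. Put $\mathfrak F^{j}_{\mathbf n}=\bigvee\{\mathfrak F_{\mathbf m}:\mathbf m\in\mathbb N^d,\ m_j=n_j\}$ and $\mathcal G_{\mathbf n}=\bigvee_{j=1}^d\mathfrak F^{j}_{\mathbf n}$, and, for $\mathbf n\ge\mathbf 1$, $\widetilde{\mathfrak F}_{\mathbf n-\mathbf 1}=\mathcal G_{\mathbf n-\mathbf 1}\cap\mathfrak F_{\mathbf n}$. Assume - (F1) $\mathfrak F_{\mathbf k}\subseteq\mathfrak F_{\mathbf n}$ whenever $\mathbf k\le\mathbf n$; - (F3) $\mathfrak F_{\mathbf 0}$ contains every $A\in\mathfrak F$ with $P(A)=0$; - (F4) $E(Y\mid\mathfrak F_{\mathbf n})=E(Y\mid\mathfrak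 F_{\mathbf n\wedge\mathbf k})$ a.s. for all $\mathbf k,\mathbf n\in\mathbb N^d$ and every bounded $\mathfrak F_{\mathbf k}$-measurable random variable $Y$; - (F5) if $d>2$: $E\bigl(E(Y\mid\mathfrak F_{\mathbf n})\mid\mathcal G_{\mathbf n-\mathbf 1}\bigr)=E(Y\mid\widetilde{\mathfrak F}_{\mathbf n-\mathbf 1})$ a.s. for every $\mathbf n\ge\mathbf 1$ and every bounded random variable $Y$. Let $(X_{\mathbf n})_{\mathbf n\in\mathbb N^d}$ be integrable real random variables such that - (X1) $X_{\mathbf n}=0$ if $|\mathbf n|=0$; - (X2) $X_{\mathbf n}$ is $\mathfrak F_{\mathbf n}$-measurable for every $\mathbf n$. Let $S_{\mathbf n}=\sum_{\mathbf k\le\mathbf n}X_{\mathbf k}$, $x,y>0$ and $1\le r\le 2$. (a) Assume (X3): $E(X_{\mathbf k}\mid\widetilde{\mathfrak F}_{\mathbf k-\mathbf 1})\le 0$ a.s. for every $\mathbf k\ge\mathbf 1$. Let $b_{\mathbf k},d_{\mathbf k}>0$ be constants such that for every $\mathbf k\ge\mathbf 1$, a.s., $$E\bigl(|X_{\mathbf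 k}|^r I[|X_{\mathbf k}|\le y]\mid\widetilde{\mathfrak F}_{\mathbf k-\mathbf 1}\bigr)\le b_{\mathbf k}^r,\qquad E\bigl(X_{\mathbf k}I[X_{\mathbf k}>-y]\mid\widetilde{\mathfrak F}_{\mathbf k-\mathbf 1}\bigr)\le d_{\mathbf k},$$ and put $B_{\mathbf n}^r=\sum_{\mathbf 1\le\mathbf k\le\mathbf n}b_{\mathbf k}^r$, $D_{\mathbf n}=\sum_{\mathbf 1\le\mathbf k\le\mathbf n}d_{\mathbf k}$. Then for every $\mathbf n\ge\mathbf 1$ $$P\Bigl(\max_{\mathbf k\le\mathbf n}S_{\mathbf k}\ge x\Bigr)\le P\Bigl(\max_{\mathbf k\le\mathbf n}X_{\mathbf k}\ge y\Bigr)+e^{d-1}\exp\left\{\frac xy-\left(\frac{x-D_{\mathbf n}}y+\frac{B_{\mathbf n}^r}{y^r}\right)\ln\left[\frac{xy^{r-1}}{B_{\mathbf n}^r}+1\right]\right\}.$$ (b) Assume instead (X3′): $E(X_{\mathbf k}\mid\widetilde{\mathfrak F}_{\mathbf k-\mathbf 1})=0$ a.s. for every $\mathbf k\ge\mathbf 1$.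 Let $\widetilde m_{\mathbf k},\widetilde\lambda_{\mathbf k}>0$ be constants such that for every $\mathbf k\ge\mathbf 1$ one has $E|X_{\mathbf k}|^r<\infty$ and, a.s., $$E\bigl(|X_{\mathbf k}|^r\mid\widetilde{\mathfrak F}_{\mathbf k-\mathbf 1}\bigr)\le\widetilde m_{\mathbf k}^r,\qquad E\bigl(|X_{\mathbf k}|I[|X_{\mathbf k}|>y]\mid\widetilde{\mathfrak F}_{\mathbf k-\mathbf 1}\bigr)\le\widetilde\lambda_{\mathbf k},$$ and put $\widetilde M_{\mathbf n}^r=\sum_{\mathbf 1\le\mathbf k\le\mathbf n}\widetilde m_{\mathbf k}^r$, $\widetilde\Lambda_{\mathbf n}=\sum_{\mathbf 1\le\mathbf k\le\mathbf n}\widetilde\lambda_{\mathbf k}$. Then for every $\mathbf n\ge\mathbf 1$ $$P\Bigl(\max_{\mathbf k\le\mathbf n}|S_{\mathbf k}|\ge x\Bigr)\le P\Bigl(\max_{\mathbf k\le\mathbf n}|X_{\mathbf k}|\ge y\Bigr)+2e^{d-1}\exp\left\{\frac xy-\left(\frac{x-\widetilde\Lambda_{\mathbf n}}y+\frac{\widetilde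 M_{\mathbf n}^r}{y^r}\right)\ln\left[\frac{xy^{r-1}}{\widetilde M_{\mathbf n}^r}+1\right]\right\}.$$ -/

import Mathlib

open MeasureTheory

namespace RandomField

variable {d : ℕ} {Ω : Type*} {mΩ : MeasurableSpace Ω}

/-- The sigma-algebra `F_n^J`: the join of all `F_m` whose coordinates in `J` agree with those of
`n`, the remaining coordinates being arbitrary. -/
abbrev sigmaOn (F : Filtration (Fin d → ℕ) mΩ) (J : Set (Fin d)) (n : Fin d → ℕ) :
    MeasurableSpace Ω :=
  ⨆ m : Fin d → ℕ, ⨆ _ : ∀ j ∈ J, m j = n j, F m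

/-- The sigma-algebra `G_n`, the join of the `F_n^{j}` over the coordinates `j`. -/
abbrev sigmaG (F : Filtration (Fin d → ℕ) mΩ) (n : Fin d → ℕ) : MeasurableSpace Ω :=
  ⨆ j : Fin d, sigmaOn F {j} n

/-- For `1 ≤ n`, the intersection of `G_{n-1}` and `F_n` (the `F`-tilde of index `n - 1`).
It is used only for `1 ≤ n`, where the coordinatewise subtraction does not truncate. -/
abbrev sigmaTildePred (F : Filtration (Fin d → ℕ) mΩ) (n : Fin d → ℕ) : MeasurableSpace Ω :=
  sigmaG F (n - 1) ⊓ F n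

/-- Condition (F3): `F_0` contains all null events. -/
def CondF3 (P : Measure Ω) (F : Filtration (Fin d → ℕ) mΩ) : Prop :=
  ∀ s : Set Ω, MeasurableSet s → P s = 0 → MeasurableSet[F 0] s

/-- Condition (F4), the commutation hypothesis. -/
def CondF4 (P : Measure Ω) (F : Filtration (Fin d → ℕ) mΩ) : Prop :=
  ∀ (k n : Fin d → ℕ) (Y : Ω → ℝ), Measurable[F k] Y → (∃ C : ℝ, ∀ ω, |Y ω| ≤ C) →
    P[Y | F n] =ᵐ[P] P[Y | F (n ⊓ k)]

/-- Condition (F5). -/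
def CondF5 (P : Measure Ω) (F : Filtration (Fin d → ℕ) mΩ) : Prop :=
  ∀ n : Fin d → ℕ, 1 ≤ n → ∀ Y : Ω → ℝ, Measurable Y → (∃ C : ℝ, ∀ ω, |Y ω| ≤ C) →
    P[P[Y | F n] | sigmaG F (n - 1)] =ᵐ[P] P[Y | sigmaTildePred F n]

/-- Condition (X1): the field vanishes at indices with a zero coordinate. -/
def CondX1 (X : (Fin d → ℕ) → Ω → ℝ) : Prop :=
  ∀ n : Fin d → ℕ, ∏ i, n i = 0 → X n = 0

/-- Condition (X2): the field is adapted. -/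
def CondX2 (F : Filtration (Fin d → ℕ) mΩ) (X : (Fin d → ℕ) → Ω → ℝ) : Prop :=
  ∀ n, Measurable[F n] (X n)

/-- Condition (X3). -/
def CondX3 (P : Measure Ω) (F : Filtration (Fin d → ℕ) mΩ) (X : (Fin d → ℕ) → Ω → ℝ) : Prop :=
  ∀ n : Fin d → ℕ, 1 ≤ n → P[X n | sigmaTildePred F n] ≤ᵐ[P] 0

/-- Condition (X3'). -/
def CondX3' (P : Measure Ω) (F : Filtration (Fin d → ℕ) mΩ) (X : (Fin d → ℕ) → Ω → ℝ) : Prop :=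
  ∀ n : Fin d → ℕ, 1 ≤ n → P[X n | sigmaTildePred F n] =ᵐ[P] 0

/-- The partial sums `S_n = ∑_{k ≤ n} X_k`. -/
def partialSum (X : (Fin d → ℕ) → Ω → ℝ) (n : Fin d → ℕ) (ω : Ω) : ℝ :=
  ∑ k ∈ Finset.Iic n, X k ω

/-- The maximum of `Y_k` over all `k ≤ n`. -/
def maxUpTo (Y : (Fin d → ℕ) → Ω → ℝ) (n : Fin d → ℕ) (ω : Ω) : ℝ :=
  (Finset.Iic n).sup' Finset.nonempty_Iic (fun k => Y k ω)

/-- The sum of the real numbers `a_k` over `1 ≤ k ≤ n`. -/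
def boxSum (a : (Fin d → ℕ) → ℝ) (n : Fin d → ℕ) : ℝ :=
  ∑ k ∈ Finset.Icc 1 n, a k

end RandomField

/-! Truncation reduces both parts to a field `η` with `|η k| ≤ y`. In (a), outside the event that
some `X_k` with `k ≤ n` reaches `y`, each such `X_k` is at most its truncation. In (b), outside the
event that some `|X_k|` reaches `y`, the two coincide, and the bounded estimate is applied to the
truncated field and to its negative.

For bounded `η`, subtract the conditional mean `V_k` given F-tilde and set `ξ_k = h (η_k - V_k)`.
Since `V_k ≤ δ_k` almost surely, a sum of `η` reaching `x` forces the matching sum of `ξ` to reach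
`h (x - D_n)`. Three ingredients then finish the proof.

Maximal inequality. By (F4), `ξ_k` is centred given any `F_m` with `m_j < k_j`, so its sums are a
martingale in each coordinate (`martingale_sum_Icc`). One coordinate is handled by the exponential
tail bound `measureReal_le_runMax_le`. Each of the other `d - 1` costs a factor `e` through `E
exp(max f) ≤ e E exp(f_n)` (`integral_exp_runMax_le`), which gives `e^{d-1}`.

Exponential moment. The mean of the product of the `exp ξ_k` is bounded by peeling off a factor with
maximal index (`integral_prod_le`). This needs control given all remaining factors together, hence
given a join of several `F_m` (`boxPast`): (F5) supplies it for `d > 2`, and for `d = 2` applying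
(F4) twice is enough. Each factor has conditional mean at most `exp(g β_k)`, where `g = (e^{hy} - 1
- hy)/y^r`, because `e^{ht} ≤ 1 + ht + g |t|^r` on `|t| ≤ y`.

Choice of `h`. Taking `h = ln(1 + x y^{r-1}/B)/y` produces the stated exponent. -/

namespace RandomField

/-- A real function that is bounded everywhere. -/
def Bdd {Ω : Type*} (f : Ω → ℝ) : Prop := ∃ C : ℝ, ∀ ω, |f ω| ≤ C

/-! ### Closure properties of bounded functions -/

namespace Bdd

variable {Ω : Type*} {f g : Ω → ℝ}

theorem const (c : ℝ) : Bdd (fun _ : Ω => c) := ⟨|c|, fun _ => le_rfl⟩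

theorem add (hf : Bdd f) (hg : Bdd g) : Bdd (fun ω => f ω + g ω) := by
  obtain ⟨C, hC⟩ := hf
  obtain ⟨D, hD⟩ := hg
  exact ⟨C + D, fun ω => (abs_add_le _ _).trans (add_le_add (hC ω) (hD ω))⟩

theorem neg (hf : Bdd f) : Bdd (fun ω => -f ω) := by
  obtain ⟨C, hC⟩ := hf
  exact ⟨C, fun ω => by simpa using hC ω⟩

theorem sub (hf : Bdd f) (hg : Bdd g) : Bdd (fun ω => f ω - g ω) := by
  simpa only [sub_eq_add_neg] using hf.add hg.neg

theorem mul (hf : Bdd f) (hg : Bdd g) : Bdd (fun ω => f ω * g ω) := by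
  obtain ⟨C, hC⟩ := hf
  obtain ⟨D, hD⟩ := hg
  refine ⟨C * D, fun ω => ?_⟩
  rw [abs_mul]
  exact mul_le_mul (hC ω) (hD ω) (abs_nonneg _) ((abs_nonneg _).trans (hC ω))

theorem exp (hf : Bdd f) : Bdd (fun ω => Real.exp (f ω)) := by
  obtain ⟨C, hC⟩ := hf
  refine ⟨Real.exp C, fun ω => ?_⟩
  rw [abs_of_pos (Real.exp_pos _)]
  exact Real.exp_le_exp.2 ((le_abs_self _).trans (hC ω))

theorem max (hf : Bdd f) (hg : Bdd g) : Bdd (fun ω => max (f ω) (g ω)) := by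
  obtain ⟨C, hC⟩ := hf
  obtain ⟨D, hD⟩ := hg
  exact ⟨Max.max C D, fun ω => abs_max_le_max_abs_abs.trans (max_le_max (hC ω) (hD ω))⟩

theorem indicator_one (s : Set Ω) : Bdd (s.indicator (fun _ => (1 : ℝ))) := by
  refine ⟨1, fun ω => ?_⟩
  by_cases h : ω ∈ s <;> simp [h]

theorem sum {ι : Type*} (s : Finset ι) {u : ι → Ω → ℝ} (h : ∀ i ∈ s, Bdd (u i)) :
    Bdd (fun ω => ∑ i ∈ s, u i ω) := by
  classical
  induction s using Finset.induction_on with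
  | empty => simpa using Bdd.const 0
  | insert a s ha ih =>
    simp only [Finset.sum_insert ha]
    exact (h a (Finset.mem_insert_self _ _)).add
      (ih fun i hi => h i (Finset.mem_insert_of_mem hi))

theorem prod {ι : Type*} (s : Finset ι) {u : ι → Ω → ℝ} (h : ∀ i ∈ s, Bdd (u i)) :
    Bdd (fun ω => ∏ i ∈ s, u i ω) := by
  classical
  induction s using Finset.induction_on with
  | empty => simpa using Bdd.const 1
  | insert a s ha ih =>
    simp only [Finset.prod_insert ha]
    exact (h a (Finset.mem_insert_self _ _)).mul
      (ih fun i hi => h i (Finset.mem_insert_of_mem hi))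

theorem sup' {ι : Type*} (s : Finset ι) (hs : s.Nonempty) {u : ι → Ω → ℝ}
    (h : ∀ i ∈ s, Bdd (u i)) : Bdd (fun ω => s.sup' hs fun i => u i ω) := by
  classical
  induction hs using Finset.Nonempty.cons_induction with
  | singleton a => simpa using h a (Finset.mem_singleton_self a)
  | cons a s ha hs ih =>
    simp only [Finset.sup'_cons hs]
    exact (h a (Finset.mem_cons_self _ _)).max (ih fun i hi => h i (Finset.mem_cons_of_mem hi))

theorem integrable {mΩ : MeasurableSpace Ω} {P : Measure Ω} [IsFiniteMeasure P]
    (hf : Bdd f) (hm : Measurable f) : Integrable f P := by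
  obtain ⟨C, hC⟩ := hf
  exact Integrable.of_bound hm.aestronglyMeasurable C (.of_forall hC)

end Bdd

variable {Ω : Type*} {mΩ : MeasurableSpace Ω} {P : Measure Ω}

theorem integral_mul_condExp [IsFiniteMeasure P] {m : MeasurableSpace Ω} (hm : m ≤ mΩ) {W Z : Ω → ℝ}
    (hW : Measurable[m] W) (hWb : Bdd W) (hZ : Integrable Z P) :
    ∫ ω, W ω * (P[Z | m]) ω ∂P = ∫ ω, W ω * Z ω ∂P := by
  obtain ⟨C, hC⟩ := hWb
  have h := condExp_stronglyMeasurable_mul_of_bound (μ := P) hm hW.stronglyMeasurable hZ C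
    (.of_forall hC)
  calc ∫ ω, W ω * (P[Z | m]) ω ∂P = ∫ ω, (P[W * Z | m]) ω ∂P :=
        integral_congr_ae (h.mono fun ω hω => by simpa using hω.symm)
    _ = ∫ ω, W ω * Z ω ∂P := integral_condExp hm

/-! ### One-parameter maximal inequalities of exponential type -/

section Doob

variable {ℱ : Filtration ℕ mΩ} {f : ℕ → Ω → ℝ}

theorem integral_mul_sub_nonneg_of_submartingale [IsFiniteMeasure P] (hf : Submartingale f ℱ P) (i : ℕ) {W : Ω → ℝ}
    (hW : Measurable[ℱ i] W) (hWb : Bdd W) (hW0 : ∀ ω, 0 ≤ W ω) :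
    0 ≤ ∫ ω, W ω * (f (i + 1) ω - f i ω) ∂P := by
  have h1 := integral_mul_condExp (P := P) (ℱ.le i) hW hWb
    ((hf.integrable (i + 1)).sub (hf.integrable i))
  have h2 := hf.condExp_sub_nonneg (Nat.le_succ i)
  calc (0 : ℝ) ≤ ∫ ω, W ω * (P[f (i + 1) - f i | ℱ i]) ω ∂P :=
        integral_nonneg_of_ae (h2.mono fun ω hω => mul_nonneg (hW0 ω) hω)
    _ = _ := h1

/-- The running maximum of a sequence of functions. -/
def runMax (f : ℕ → Ω → ℝ) : ℕ → Ω → ℝ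
  | 0 => f 0
  | n + 1 => fun ω => max (runMax f n ω) (f (n + 1) ω)

theorem le_runMax (f : ℕ → Ω → ℝ) {i n : ℕ} (h : i ≤ n) (ω : Ω) : f i ω ≤ runMax f n ω := by
  induction n with
  | zero => obtain rfl : i = 0 := by omega
            exact le_rfl
  | succ n ih =>
    rcases Nat.lt_or_ge n i with h' | h'
    · obtain rfl : i = n + 1 := by omega
      exact le_max_right _ _
    · exact (ih h').trans (le_max_left _ _)

theorem bdd_runMax (hb : ∀ i, Bdd (f i)) (n : ℕ) : Bdd (runMax f n) := by
  induction n with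
  | zero => exact hb 0
  | succ n ih => exact ih.max (hb (n + 1))

theorem measurable_runMax (hf : Submartingale f ℱ P) (n : ℕ) : Measurable[ℱ n] (runMax f n) := by
  induction n with
  | zero => exact (hf.stronglyMeasurable 0).measurable
  | succ n ih =>
    exact (ih.mono (ℱ.mono (Nat.le_succ n)) le_rfl).max (hf.stronglyMeasurable (n + 1)).measurable

/-- Doob's inequality for the exponential of the running maximum of a bounded submartingale. -/
theorem integral_exp_runMax_le [IsProbabilityMeasure P] (hf : Submartingale f ℱ P) (hb : ∀ i, Bdd (f i)) (n : ℕ) :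
    ∫ ω, Real.exp (runMax f n ω) ∂P ≤ Real.exp 1 * ∫ ω, Real.exp (f n ω) ∂P := by
  have hfm : ∀ i, Measurable (f i) := fun i =>
    ((hf.stronglyMeasurable i).measurable.mono (ℱ.le i) le_rfl)
  have hmm : ∀ i, Measurable (runMax f i) := fun i =>
    ((measurable_runMax hf i).mono (ℱ.le i) le_rfl)
  have hbm := bdd_runMax hb
  have hI : ∀ i j, Integrable
      (fun ω => Real.exp (runMax f i ω) * (f j ω - runMax f i ω + 1)) P := fun i j =>
    ((hbm i).exp.mul (((hb j).sub (hbm i)).add (.const 1))).integrable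
      ((hmm i).exp.mul (((hfm j).sub (hmm i)).add_const 1))
  -- With `M` the running maximum, `E[e^M (f_n - M + 1)] ≥ 0` by induction. Passing from `f_n` to
  -- `f_{n+1}` with `M` fixed is the submartingale property. Updating `M` either changes nothing or
  -- yields `e^{f_{n+1}}`, which dominates `e^M (f_{n+1} - M + 1)`.
  have key : 0 ≤ ∫ ω, Real.exp (runMax f n ω) * (f n ω - runMax f n ω + 1) ∂P := by
    induction n with
    | zero =>
      refine integral_nonneg fun ω => ?_
      simpa [runMax] using (Real.exp_pos _).le
    | succ n ih =>
      have h1 := integral_mul_sub_nonneg_of_submartingale hf n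
        ((measurable_runMax hf n).exp) (hbm n).exp (fun ω => (Real.exp_pos _).le)
      have h2 : ∫ ω, Real.exp (runMax f n ω) * (f (n + 1) ω - runMax f n ω + 1) ∂P =
          (∫ ω, Real.exp (runMax f n ω) * (f n ω - runMax f n ω + 1) ∂P) +
          ∫ ω, Real.exp (runMax f n ω) * (f (n + 1) ω - f n ω) ∂P := by
        rw [← integral_add (hI n n)
          (((hbm n).exp.mul ((hb _).sub (hb _))).integrable
            ((hmm n).exp.mul ((hfm _).sub (hfm _))))]
        exact integral_congr_ae (.of_forall fun ω => by ring)
      refine (add_nonneg ih h1).trans (h2.symm.le.trans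
        (integral_mono (hI n (n + 1)) (hI (n + 1) (n + 1)) fun ω => ?_))
      simp only [runMax]
      rcases le_total (f (n + 1) ω) (runMax f n ω) with h | h
      · rw [max_eq_left h]
      · rw [max_eq_right h]
        have h3 := Real.add_one_le_exp (f (n + 1) ω - runMax f n ω)
        calc _ ≤ Real.exp (runMax f n ω) * Real.exp (f (n + 1) ω - runMax f n ω) :=
              mul_le_mul_of_nonneg_left h3 (Real.exp_pos _).le
          _ = _ := by rw [← Real.exp_add]; simp
  have h4 : ∫ ω, Real.exp (runMax f n ω) ∂P +
      ∫ ω, Real.exp (runMax f n ω) * (f n ω - runMax f n ω + 1) ∂P ≤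
      ∫ ω, Real.exp 1 * Real.exp (f n ω) ∂P := by
    rw [← integral_add ((hbm n).exp.integrable (hmm n).exp) (hI n n)]
    refine integral_mono (((hbm n).exp.integrable (hmm n).exp).add (hI n n))
      (((hb n).exp.integrable (hfm n).exp).const_mul _) fun ω => ?_
    -- Multiplied by `e^M`, this reads `e^M + e^M (f_n - M + 1) ≤ e · e^{f_n}`, and the second term
    -- on the left has nonnegative mean by `key`.
    have h5 := Real.add_one_le_exp (1 - (runMax f n ω - f n ω))
    have h6 : Real.exp 1 * Real.exp (f n ω) =
        Real.exp (runMax f n ω) * Real.exp (1 - (runMax f n ω - f n ω)) := by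
      rw [← Real.exp_add, ← Real.exp_add]; ring_nf
    have h7 := mul_le_mul_of_nonneg_left h5 (Real.exp_pos (runMax f n ω)).le
    simp only
    rw [h6]
    refine le_trans (le_of_eq ?_) h7
    ring
  rw [integral_const_mul] at h4
  linarith

/-- The exponential maximal inequality for a bounded submartingale. -/
theorem measureReal_le_runMax_le [IsProbabilityMeasure P] (hf : Submartingale f ℱ P) (hb : ∀ i, Bdd (f i)) (a : ℝ)
    (n : ℕ) : P.real {ω | a ≤ runMax f n ω} ≤ Real.exp (-a) * ∫ ω, Real.exp (f n ω) ∂P := by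
  have hfm : ∀ i, Measurable (f i) := fun i =>
    ((hf.stronglyMeasurable i).measurable.mono (ℱ.le i) le_rfl)
  have hset : ∀ i, MeasurableSet[ℱ i] {ω | a ≤ runMax f i ω} := fun i =>
    measurable_runMax hf i measurableSet_Ici
  set W : ℕ → Ω → ℝ := fun i => {ω | a ≤ runMax f i ω}.indicator fun _ => (1 : ℝ) with hW
  have hWm : ∀ i, Measurable[ℱ i] (W i) := fun i =>
    (@measurable_const _ _ _ (ℱ i) 1).indicator (hset i)
  have hWm' : ∀ i, Measurable (W i) := fun i => (hWm i).mono (ℱ.le i) le_rfl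
  have hWb : ∀ i, Bdd (W i) := fun i => Bdd.indicator_one _
  have hW0 : ∀ i ω, 0 ≤ W i ω := fun i ω => Set.indicator_nonneg (fun _ _ => zero_le_one) _
  have hI : ∀ i j, Integrable (fun ω => W i ω * (f j ω - a)) P := fun i j =>
    ((hWb i).mul ((hb j).sub (.const a))).integrable ((hWm' i).mul ((hfm j).sub_const a))
  -- When the maximum first reaches `a` at time `n + 1`, the new contribution `f_{n+1} - a` is
  -- nonnegative; on the event already reached, the submartingale increment is used.
  have key : 0 ≤ ∫ ω, W n ω * (f n ω - a) ∂P := by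
    induction n with
    | zero =>
      refine integral_nonneg fun ω => ?_
      by_cases h : a ≤ f 0 ω <;> simp [hW, runMax, h]
    | succ n ih =>
      have h1 := integral_mul_sub_nonneg_of_submartingale hf n (hWm n) (hWb n) (hW0 n)
      have h2 : ∫ ω, W n ω * (f (n + 1) ω - a) ∂P =
          (∫ ω, W n ω * (f n ω - a) ∂P) + ∫ ω, W n ω * (f (n + 1) ω - f n ω) ∂P := by
        rw [← integral_add (hI n n) (((hWb n).mul ((hb _).sub (hb _))).integrable
            ((hWm' n).mul ((hfm _).sub (hfm _))))]
        exact integral_congr_ae (.of_forall fun ω => by ring)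
      refine (add_nonneg ih h1).trans (h2.symm.le.trans
        (integral_mono (hI n (n + 1)) (hI (n + 1) (n + 1)) fun ω => ?_))
      by_cases h : a ≤ runMax f n ω
      · simp [hW, runMax, h]
      · by_cases h' : a ≤ f (n + 1) ω <;> simp [hW, runMax, h, h']
  have h4 : P.real {ω | a ≤ runMax f n ω} = ∫ ω, W n ω ∂P := by
    rw [hW, integral_indicator_const _ ((ℱ.le n) _ (hset n))]
    simp
  have h5 : (∫ ω, W n ω ∂P) + ∫ ω, W n ω * (f n ω - a) ∂P ≤
      ∫ ω, Real.exp (-a) * Real.exp (f n ω) ∂P := by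
    rw [← integral_add ((hWb n).integrable (hWm' n)) (hI n n)]
    refine integral_mono (((hWb n).integrable (hWm' n)).add (hI n n))
      (((hb n).exp.integrable (hfm n).exp).const_mul _) fun ω => ?_
    have h6 := Real.add_one_le_exp (f n ω - a)
    have h7 := Real.exp_pos (f n ω - a)
    have h8 : Real.exp (-a) * Real.exp (f n ω) = Real.exp (f n ω - a) := by
      rw [← Real.exp_add]; ring_nf
    simp only
    rw [h8]
    by_cases h : a ≤ runMax f n ω
    · simp [hW, h]; linarith
    · simp [hW, h]; exact h7.le
  rw [integral_const_mul] at h5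
  linarith

theorem submartingale_sup' {ι : Type*} (s : Finset ι) (hs : s.Nonempty) {u : ι → ℕ → Ω → ℝ}
    (h : ∀ i ∈ s, Submartingale (u i) ℱ P) :
    Submartingale (fun n ω => s.sup' hs fun i => u i n ω) ℱ P := by
  classical
  induction hs using Finset.Nonempty.cons_induction with
  | singleton a => simpa using h a (Finset.mem_singleton_self a)
  | cons a s ha hs ih =>
    simp only [Finset.sup'_cons hs]
    exact (h a (Finset.mem_cons_self _ _)).sup (ih fun i hi => h i (Finset.mem_cons_of_mem hi))

end Doob

/-! ### Centring given joins of sigma-algebras, and the mean of a product -/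

section Orthogonality

variable {d : ℕ} {Ω : Type*} {mΩ : MeasurableSpace Ω} {P : Measure Ω}
  {F : Filtration (Fin d → ℕ) mΩ}

theorem le_sigmaG (F : Filtration (Fin d → ℕ) mΩ) {a b : Fin d → ℕ} {j : Fin d} (h : a j ≤ b j) :
    F a ≤ sigmaG F b := by
  have h1 : F a ≤ F (Function.update a j (b j)) := F.mono (by
    intro i
    rcases eq_or_ne i j with rfl | hij
    · simpa using h
    · simp [hij])
  refine h1.trans (le_trans ?_ (le_iSup (fun j => sigmaOn F {j} b) j))
  exact le_iSup₂_of_le (Function.update a j (b j)) (by simp) le_rfl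

theorem le_sigmaTildePred (F : Filtration (Fin d → ℕ) mΩ) {a k : Fin d → ℕ} (hak : a ≤ k)
    {j : Fin d} (h : a j < k j) : F a ≤ sigmaTildePred F k :=
  le_inf (le_sigmaG F (j := j) (by simp only [Pi.sub_apply, Pi.one_apply]; omega)) (F.mono hak)

theorem sigmaTildePred_le (F : Filtration (Fin d → ℕ) mΩ) (k : Fin d → ℕ) :
    sigmaTildePred F k ≤ mΩ :=
  inf_le_right.trans (F.le k)

/-- The join of the sigma-algebras `F_m` over the largest indices `m ≤ n` that are smaller than
`k` in some coordinate. -/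
abbrev boxPast (F : Filtration (Fin d → ℕ) mΩ) (n k : Fin d → ℕ) : MeasurableSpace Ω :=
  ⨆ j : Fin d, F (Function.update n j (k j - 1))

theorem boxPast_le (F : Filtration (Fin d → ℕ) mΩ) (n k : Fin d → ℕ) : boxPast F n k ≤ mΩ :=
  iSup_le fun _ => F.le _

theorem le_boxPast (F : Filtration (Fin d → ℕ) mΩ) {n k m : Fin d → ℕ} (hmn : m ≤ n)
    (hkm : ¬ k ≤ m) : F m ≤ boxPast F n k := by
  obtain ⟨j, hj⟩ : ∃ j, m j < k j := by simpa [Pi.le_def] using hkm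
  refine le_trans (F.mono ?_) (le_iSup (fun j => F (Function.update n j (k j - 1))) j)
  intro i
  rcases eq_or_ne i j with rfl | hij
  · simp only [Function.update_self]; omega
  · simpa [hij] using hmn i

/-- Under (F4), an `F_k`-measurable variable that is centred given `F`-tilde is centred given any
`F_m` whose index is smaller than `k` in some coordinate. -/
theorem condExp_eq_zero_of_lt [IsFiniteMeasure P] (hF4 : CondF4 P F) {k m : Fin d → ℕ} {U : Ω → ℝ}
    (hU : Measurable[F k] U) (hUb : Bdd U) (h0 : P[U | sigmaTildePred F k] =ᵐ[P] 0)
    {j : Fin d} (hj : m j < k j) : P[U | F m] =ᵐ[P] 0 := by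
  refine (hF4 k m U hU hUb).trans ?_
  have hle : F (m ⊓ k) ≤ sigmaTildePred F k :=
    le_sigmaTildePred F inf_le_right (j := j) (by simpa [Pi.inf_apply] using hj)
  have h1 := condExp_condExp_of_le (μ := P) (f := U) hle (sigmaTildePred_le F k)
  refine h1.symm.trans ((condExp_congr_ae h0).trans ?_)
  rw [condExp_zero]

theorem integral_mul_eq_zero_of_condExp [IsFiniteMeasure P] {m : MeasurableSpace Ω} (hm : m ≤ mΩ) {W U : Ω → ℝ}
    (hW : Measurable[m] W) (hWb : Bdd W) (hU : Integrable U P) (h0 : P[U | m] =ᵐ[P] 0) :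
    ∫ ω, W ω * U ω ∂P = 0 := by
  rw [← integral_mul_condExp hm hW hWb hU]
  exact integral_eq_zero_of_ae (h0.mono fun ω hω => by simp [hω])

/-- Clipping the conditional expectation to `[-C, C]` alters it only on a null set and makes it
bounded everywhere. -/
theorem exists_bdd_condExp {m : MeasurableSpace Ω} {Z : Ω → ℝ} (hZ : Bdd Z) :
    ∃ V : Ω → ℝ, Measurable[m] V ∧ Bdd V ∧ V =ᵐ[P] P[Z | m] := by
  obtain ⟨C, hC⟩ := hZ
  have h := ae_bdd_abs_condExp_of_ae_bdd_abs (m := m) (μ := P) (.of_forall hC)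
  refine ⟨fun ω => max (-C) (min C ((P[Z | m]) ω)), ?_, ⟨C, fun ω => ?_⟩, ?_⟩
  · exact (@measurable_const _ _ _ m _).max
      ((@measurable_const _ _ _ m _).min stronglyMeasurable_condExp.measurable)
  · exact abs_le.2 ⟨le_max_left _ _, max_le (by linarith [(abs_nonneg _).trans (hC ω)]) (min_le_left _ _)⟩
  · filter_upwards [h] with ω hω
    rw [min_eq_right (abs_le.1 hω).2, max_eq_right (abs_le.1 hω).1]

/-- Replacing a bounded variable by its conditional expectation given `F_{n ∧ k}`. -/
theorem exists_integral_mul_eq_of_condF4 [IsFiniteMeasure P] (hF4 : CondF4 P F) (k n : Fin d → ℕ) {Y : Ω → ℝ}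
    (hY : Measurable[F k] Y) (hYb : Bdd Y) : ∃ V : Ω → ℝ, Measurable[F (n ⊓ k)] V ∧ Bdd V ∧
      ∀ W : Ω → ℝ, Measurable[F n] W → Bdd W → ∫ ω, W ω * Y ω ∂P = ∫ ω, W ω * V ω ∂P := by
  obtain ⟨V, hVm, hVb, hV⟩ := exists_bdd_condExp (P := P) (m := F (n ⊓ k)) hYb
  refine ⟨V, hVm, hVb, fun W hW hWb => ?_⟩
  rw [← integral_mul_condExp (F.le n) hW hWb (hYb.integrable (hY.mono (F.le k) le_rfl))]
  refine integral_congr_ae ?_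
  filter_upwards [hF4 k n Y hY hYb, hV] with ω h1 h2
  rw [h1, h2]

/-- The sets `A ∩ B` form a π-system generating the join, so the π-λ argument applies. -/
theorem setIntegral_eq_zero_of_sup {m₁ m₂ : MeasurableSpace Ω} (h₁ : m₁ ≤ mΩ) (h₂ : m₂ ≤ mΩ)
    {U : Ω → ℝ} (hU : Integrable U P)
    (h : ∀ A B, MeasurableSet[m₁] A → MeasurableSet[m₂] B → ∫ ω in A ∩ B, U ω ∂P = 0)
    (s : Set Ω) (hs : MeasurableSet[m₁ ⊔ m₂] s) : ∫ ω in s, U ω ∂P = 0 := by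
  have hle : m₁ ⊔ m₂ ≤ mΩ := sup_le h₁ h₂
  have h_eq : m₁ ⊔ m₂ = MeasurableSpace.generateFrom
      {t | ∃ A B, MeasurableSet[m₁] A ∧ MeasurableSet[m₂] B ∧ t = A ∩ B} := by
    refine le_antisymm (sup_le ?_ ?_) (MeasurableSpace.generateFrom_le ?_)
    · intro A hA
      exact MeasurableSpace.measurableSet_generateFrom
        ⟨A, Set.univ, hA, MeasurableSet.univ, by simp⟩
    · intro B hB
      exact MeasurableSpace.measurableSet_generateFrom
        ⟨Set.univ, B, MeasurableSet.univ, hB, by simp⟩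
    · rintro t ⟨A, B, hA, hB, rfl⟩
      exact @MeasurableSet.inter _ (m₁ ⊔ m₂) _ _ ((le_sup_left : m₁ ≤ m₁ ⊔ m₂) _ hA)
        ((le_sup_right : m₂ ≤ m₁ ⊔ m₂) _ hB)
  have huniv : ∫ ω, U ω ∂P = 0 := by
    simpa using h Set.univ Set.univ MeasurableSet.univ MeasurableSet.univ
  induction s, hs using MeasurableSpace.induction_on_inter h_eq with
  | h_inter =>
    rintro _ ⟨A, B, hA, hB, rfl⟩ _ ⟨A', B', hA', hB', rfl⟩ -
    exact ⟨A ∩ A', B ∩ B', hA.inter hA', hB.inter hB', Set.inter_inter_inter_comm _ _ _ _⟩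
  | empty => simp
  | basic t ht =>
    obtain ⟨A, B, hA, hB, rfl⟩ := ht
    exact h A B hA hB
  | compl t ht ih =>
    have := integral_add_compl (hle _ ht) hU
    linarith
  | iUnion f hdisj hf ih =>
    rw [integral_iUnion (fun i => hle _ (hf i)) hdisj hU.integrableOn]
    simp [ih]

variable [IsProbabilityMeasure P]

/-- The two-parameter case, in which (F4) suffices. -/
theorem condExp_boxPast_eq_zero_of_two {F : Filtration (Fin 2 → ℕ) mΩ} (hF4 : CondF4 P F)
    {k n : Fin 2 → ℕ} (hk : 1 ≤ k) (hkn : k ≤ n) {U : Ω → ℝ} (hU : Measurable[F k] U)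
    (hUb : Bdd U) (h0 : P[U | sigmaTildePred F k] =ᵐ[P] 0) : P[U | boxPast F n k] =ᵐ[P] 0 := by
  have hUi : Integrable U P := hUb.integrable (hU.mono (F.le k) le_rfl)
  have hk0 : 1 ≤ k 0 := hk 0
  have hk1 : 1 ≤ k 1 := hk 1
  have hn0 : k 0 ≤ n 0 := hkn 0
  have hn1 : k 1 ≤ n 1 := hkn 1
  set a : Fin 2 → ℕ := Function.update n 0 (k 0 - 1) with ha
  set b : Fin 2 → ℕ := Function.update n 1 (k 1 - 1) with hb
  have a0 : a 0 = k 0 - 1 := by simp [ha]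
  have a1 : a 1 = n 1 := by simp [ha]
  have b0 : b 0 = n 0 := by simp [hb]
  have b1 : b 1 = k 1 - 1 := by simp [hb]
  have hbox : boxPast F n k = F a ⊔ F b := by
    refine le_antisymm (iSup_le fun j => ?_) (sup_le ?_ ?_)
    · fin_cases j
      · exact le_sup_left
      · exact le_sup_right
    · exact le_iSup (fun j => F (Function.update n j (k j - 1))) 0
    · exact le_iSup (fun j => F (Function.update n j (k j - 1))) 1
  have key := setIntegral_eq_zero_of_sup (F.le a) (F.le b) hUi (fun A B hA hB => by
    set IA : Ω → ℝ := A.indicator fun _ => 1 with hIA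
    set IB : Ω → ℝ := B.indicator fun _ => 1 with hIB
    have hIAm : Measurable[F a] IA := (@measurable_const _ _ _ (F a) 1).indicator hA
    have hIBm : Measurable[F b] IB := (@measurable_const _ _ _ (F b) 1).indicator hB
    have hIAb : Bdd IA := Bdd.indicator_one A
    have hIBb : Bdd IB := Bdd.indicator_one B
    -- Here `a = (k₀ - 1, n₁)` and `b = (n₀, k₁ - 1)`. The product `U · IA` is measurable at `k ⊔ a
    -- = (k₀, n₁)`, so `IB` may be replaced by a variable at `(k₀, k₁ - 1)`. Then `U · VB` is
    -- measurable at `k`, so `IA` may be replaced by a variable at `(k₀ - 1, k₁)`. Both indices lie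
    -- strictly below `k` in one coordinate, hence inside F-tilde, to which `U` is orthogonal.
    obtain ⟨VB, hVBm, hVBb, hVB⟩ := exists_integral_mul_eq_of_condF4 hF4 b (k ⊔ a) hIBm hIBb
    obtain ⟨VA, hVAm, hVAb, hVA⟩ := exists_integral_mul_eq_of_condF4 hF4 a k hIAm hIAb
    have leB : F ((k ⊔ a) ⊓ b) ≤ sigmaTildePred F k := by
      refine le_sigmaTildePred F (fun i => ?_) (j := 1) ?_
      · fin_cases i <;> simp [a0, a1, b0, b1]
      · simp [b1]; omega
    have leA : F (k ⊓ a) ≤ sigmaTildePred F k := by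
      refine le_sigmaTildePred F inf_le_left (j := 0) ?_
      simp [a0]; omega
    have hVAm' : Measurable[sigmaTildePred F k] VA := hVAm.mono leA le_rfl
    have hVBm' : Measurable[sigmaTildePred F k] VB := hVBm.mono leB le_rfl
    have e1 : ∫ ω in A ∩ B, U ω ∂P = ∫ ω, (U ω * IA ω) * IB ω ∂P := by
      rw [← integral_indicator ((F.le a _ hA).inter (F.le b _ hB))]
      refine integral_congr_ae (.of_forall fun ω => ?_)
      by_cases h1 : ω ∈ A <;> by_cases h2 : ω ∈ B <;> simp [hIA, hIB, h1, h2]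
    have e2 : ∫ ω, (U ω * IA ω) * IB ω ∂P = ∫ ω, (U ω * IA ω) * VB ω ∂P :=
      hVB (fun ω => U ω * IA ω) ((hU.mono (F.mono le_sup_left) le_rfl).mul
        (hIAm.mono (F.mono le_sup_right) le_rfl)) (hUb.mul hIAb)
    have e3 : ∫ ω, (U ω * VB ω) * IA ω ∂P = ∫ ω, (U ω * VB ω) * VA ω ∂P :=
      hVA (fun ω => U ω * VB ω) (hU.mul (hVBm'.mono inf_le_right le_rfl)) (hUb.mul hVBb)
    have e4 : ∫ ω, (VA ω * VB ω) * U ω ∂P = 0 :=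
      integral_mul_eq_zero_of_condExp (sigmaTildePred_le F k) (hVAm'.mul hVBm')
        (hVAb.mul hVBb) hUi h0
    rw [e1, e2, ← e4]
    calc ∫ ω, (U ω * IA ω) * VB ω ∂P = ∫ ω, (U ω * VB ω) * IA ω ∂P :=
          integral_congr_ae (.of_forall fun ω => by ring)
      _ = ∫ ω, (U ω * VB ω) * VA ω ∂P := e3
      _ = _ := integral_congr_ae (.of_forall fun ω => by ring))
  rw [← hbox] at key
  refine (ae_eq_condExp_of_forall_setIntegral_eq (boxPast_le F n k) hUi
    (fun _ _ _ => (integrable_zero _ _ _).integrableOn) (fun s hs _ => ?_)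
    (@stronglyMeasurable_zero _ _ (boxPast F n k) _ _).aestronglyMeasurable).symm
  rw [key s hs]; simp

/-- For `d > 2`, (F5) applied to the `F_k`-measurable `U` centres it given `G_{k-1}`, which contains
the join. For `d = 1` the join is a single `F_m`, and (F4) suffices. -/
theorem condExp_boxPast_eq_zero (hd : 1 ≤ d) (hF4 : CondF4 P F) (hF5 : 2 < d → CondF5 P F)
    {k n : Fin d → ℕ} (hk : 1 ≤ k) (hkn : k ≤ n) {U : Ω → ℝ} (hU : Measurable[F k] U)
    (hUb : Bdd U) (h0 : P[U | sigmaTildePred F k] =ᵐ[P] 0) : P[U | boxPast F n k] =ᵐ[P] 0 := by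
  have hUm : Measurable U := hU.mono (F.le k) le_rfl
  rcases Nat.lt_or_ge 2 d with h2 | h2
  · have h5 := hF5 h2 k hk U hUm hUb
    rw [condExp_of_stronglyMeasurable (F.le k) hU.stronglyMeasurable (hUb.integrable hUm)] at h5
    have hle : boxPast F n k ≤ sigmaG F (k - 1) :=
      iSup_le fun j => le_sigmaG F (j := j) (by simp)
    refine (condExp_condExp_of_le (μ := P) (f := U) hle
      (iSup_le fun j => iSup₂_le fun m _ => F.le m)).symm.trans
      ((condExp_congr_ae (h5.trans h0)).trans ?_)
    rw [condExp_zero]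
  · obtain rfl | rfl : d = 1 ∨ d = 2 := by omega
    · have hbox : boxPast F n k = F (Function.update n 0 (k 0 - 1)) := iSup_unique _
      rw [hbox]
      refine condExp_eq_zero_of_lt hF4 hU hUb h0 (j := 0) ?_
      have : 1 ≤ k 0 := hk 0
      simp only [Function.update_self]; omega
    · exact condExp_boxPast_eq_zero_of_two hF4 hk hkn hU hUb h0

/-- If each nonnegative factor has a conditional mean bounded by `c k`, the mean of the product
over a finite set of indices is bounded by the product of the `c k`. -/
theorem integral_prod_le (hd : 1 ≤ d) (hF4 : CondF4 P F) (hF5 : 2 < d → CondF5 P F)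
    (n : Fin d → ℕ) {Z : (Fin d → ℕ) → Ω → ℝ} {c : (Fin d → ℕ) → ℝ}
    (hZ : ∀ k, Measurable[F k] (Z k)) (hZb : ∀ k, Bdd (Z k)) (hZ0 : ∀ k ω, 0 ≤ Z k ω)
    (hc : ∀ k, 0 ≤ c k)
    (h : ∀ k, 1 ≤ k → P[Z k | sigmaTildePred F k] ≤ᵐ[P] fun _ => c k)
    (s : Finset (Fin d → ℕ)) (hs : s ⊆ Finset.Icc 1 n) :
    ∫ ω, ∏ k ∈ s, Z k ω ∂P ≤ ∏ k ∈ s, c k := by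
  classical
  induction s using Finset.strongInduction with
  | H s ih =>
    rcases s.eq_empty_or_nonempty with rfl | hne
    · simp
    -- By maximality no other index of `s` dominates `k`, so every remaining factor is measurable
    -- with respect to `boxPast F n k`.
    obtain ⟨k, hk⟩ := s.exists_maximal hne
    have hks : k ∈ s := hk.prop
    obtain ⟨hk1, hkn⟩ := Finset.mem_Icc.1 (hs hks)
    have hZm : ∀ k, Measurable (Z k) := fun k => (hZ k).mono (F.le k) le_rfl
    set W : Ω → ℝ := fun ω => ∏ i ∈ s.erase k, Z i ω with hW
    have hWb : Bdd W := Bdd.prod _ fun i _ => hZb i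
    have hW0 : ∀ ω, 0 ≤ W ω := fun ω => Finset.prod_nonneg fun i _ => hZ0 i ω
    have hWm : Measurable[boxPast F n k] W := by
      refine Finset.measurable_fun_prod _ fun i hi => ?_
      obtain ⟨hik, his⟩ := Finset.mem_erase.1 hi
      refine (hZ i).mono (le_boxPast F (Finset.mem_Icc.1 (hs his)).2 fun hki => hik ?_) le_rfl
      exact le_antisymm (hk.le_of_ge his hki) hki
    have hWm' : Measurable W := hWm.mono (boxPast_le F n k) le_rfl
    obtain ⟨V, hVm, hVb, hV⟩ := exists_bdd_condExp (P := P) (m := sigmaTildePred F k) (hZb k)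
    have hVm' : Measurable V := hVm.mono (sigmaTildePred_le F k) le_rfl
    have hVi : Integrable V P := hVb.integrable hVm'
    have hUm : Measurable[F k] (Z k - V) := (hZ k).sub (hVm.mono inf_le_right le_rfl)
    have hUb : Bdd (Z k - V) := (hZb k).sub hVb
    have hU0 : P[Z k - V | sigmaTildePred F k] =ᵐ[P] 0 := by
      refine (condExp_sub ((hZb k).integrable (hZm k)) hVi _).trans ?_
      rw [condExp_of_stronglyMeasurable (sigmaTildePred_le F k) hVm.stronglyMeasurable hVi]
      filter_upwards [hV] with ω hω
      simp [hω]
    have h1 := integral_mul_eq_zero_of_condExp (boxPast_le F n k) hWm hWb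
      (hUb.integrable ((hZm k).sub hVm'))
      (condExp_boxPast_eq_zero hd hF4 hF5 hk1 hkn hUm hUb hU0)
    -- Orthogonality of `Z k - V` to the other factors lets `V`, which is at most `c k`, replace `Z
    -- k`.
    have h2 : ∫ ω, ∏ i ∈ s, Z i ω ∂P = ∫ ω, W ω * V ω ∂P := by
      have h3 : ∫ ω, W ω * (Z k - V) ω ∂P = ∫ ω, W ω * Z k ω ∂P - ∫ ω, W ω * V ω ∂P := by
        rw [← integral_sub ((hWb.mul (hZb k)).integrable (hWm'.mul (hZm k)))
          ((hWb.mul hVb).integrable (hWm'.mul hVm'))]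
        exact integral_congr_ae (.of_forall fun ω => by simp [mul_sub])
      have h4 : ∫ ω, ∏ i ∈ s, Z i ω ∂P = ∫ ω, W ω * Z k ω ∂P :=
        integral_congr_ae (.of_forall fun ω => by
          simp only [hW]; rw [Finset.prod_erase_mul _ _ hks])
      linarith
    have h5 : ∫ ω, W ω * V ω ∂P ≤ ∫ ω, W ω * c k ∂P := by
      refine integral_mono_ae ((hWb.mul hVb).integrable (hWm'.mul hVm'))
        ((hWb.integrable hWm').mul_const _) ?_
      filter_upwards [hV, h k hk1] with ω h6 h7
      exact mul_le_mul_of_nonneg_left (h6.le.trans h7) (hW0 ω)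
    rw [integral_mul_const] at h5
    rw [h2, ← Finset.prod_erase_mul _ _ hks]
    exact h5.trans (mul_le_mul_of_nonneg_right
      (ih _ (Finset.erase_ssubset hks) ((Finset.erase_subset _ _).trans hs)) (hc k))

end Orthogonality

/-! ### Maximal inequalities over boxes, one coordinate at a time -/

section BoxMax

variable {d : ℕ} {Ω : Type*} {mΩ : MeasurableSpace Ω} {P : Measure Ω}

/-- The filtration obtained from `F` by varying the `j`-th coordinate of `n`. -/
def slice (F : Filtration (Fin d → ℕ) mΩ) (n : Fin d → ℕ) (j : Fin d) : Filtration ℕ mΩ where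
  seq i := F (Function.update n j i)
  mono' _ _ h := F.mono (Function.update_mono h)
  le' _ := F.le _

/-- The indices `m ≤ n` that agree with `n` off `J`. -/
def face (J : Finset (Fin d)) (n : Fin d → ℕ) : Finset (Fin d → ℕ) :=
  (Finset.Iic n).filter fun m => ∀ i, i ∉ J → m i = n i

theorem mem_face {J : Finset (Fin d)} {n m : Fin d → ℕ} :
    m ∈ face J n ↔ m ≤ n ∧ ∀ i, i ∉ J → m i = n i := by
  simp [face]

theorem face_nonempty (J : Finset (Fin d)) (n : Fin d → ℕ) : (face J n).Nonempty :=
  ⟨n, mem_face.2 ⟨le_rfl, fun _ _ => rfl⟩⟩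

theorem face_empty (n : Fin d → ℕ) : face ∅ n = {n} := by
  ext m
  simp only [mem_face, Finset.notMem_empty, not_false_eq_true, forall_const,
    Finset.mem_singleton]
  exact ⟨fun h => funext h.2, by rintro rfl; exact ⟨le_rfl, fun _ => rfl⟩⟩

variable {F : Filtration (Fin d → ℕ) mΩ} {M : (Fin d → ℕ) → Ω → ℝ} {n : Fin d → ℕ}

/-- An index of the larger face is reached by resetting its `j`-th coordinate to `n j`, which lands
in the face of `J`, and then running the `j`-th coordinate back down. -/
theorem sup'_face_insert_le {J : Finset (Fin d)} {j : Fin d} (ω : Ω) :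
    (face (insert j J) n).sup' (face_nonempty _ n) (fun m => M m ω) ≤
      runMax (fun i ω => (face J n).sup' (face_nonempty J n)
        fun m => M (Function.update m j i) ω) (n j) ω := by
  refine Finset.sup'_le _ _ fun m hm => ?_
  obtain ⟨hmn, hmJ⟩ := mem_face.1 hm
  refine le_trans ?_ (le_runMax _ (hmn j) ω)
  have hm' : Function.update m j (n j) ∈ face J n := by
    refine mem_face.2 ⟨fun i => ?_, fun i hi => ?_⟩
    · rcases eq_or_ne i j with rfl | hij
      · simp
      · simpa [hij] using hmn i
    · rcases eq_or_ne i j with rfl | hij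
      · simp
      · simpa [hij] using hmJ i (by simp [hij, hi])
  have h := Finset.le_sup' (fun m' => M (Function.update m' j (m j)) ω) hm'
  simp only [Function.update_idem, Function.update_eq_self] at h
  exact h

theorem sup'_face_update {J : Finset (Fin d)} {j : Fin d} (hj : j ∉ J) (ω : Ω) :
    (face J n).sup' (face_nonempty J n) (fun m => M (Function.update m j (n j)) ω) =
      (face J n).sup' (face_nonempty J n) fun m => M m ω := by
  refine Finset.sup'_congr _ rfl fun m hm => ?_
  rw [← (mem_face.1 hm).2 j hj, Function.update_eq_self]

variable [IsProbabilityMeasure P]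

/-- Doob's inequality for the exponential of the maximum of a bounded field which is a
submartingale in each coordinate, the maximum running over the coordinates in `J`. -/
theorem integral_exp_sup'_face_le
    (hM : ∀ m ≤ n, ∀ j, Submartingale (fun i => M (Function.update m j i)) (slice F n j) P)
    (hb : ∀ m, Bdd (M m)) (hm : ∀ m, Measurable (M m)) (J : Finset (Fin d)) :
    ∫ ω, Real.exp ((face J n).sup' (face_nonempty J n) fun m => M m ω) ∂P ≤
      Real.exp J.card * ∫ ω, Real.exp (M n ω) ∂P := by
  classical
  induction J using Finset.induction_on with
  | empty => simp [face_empty]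
  | insert j J hj ih =>
    set f : ℕ → Ω → ℝ := fun i ω => (face J n).sup' (face_nonempty J n)
        fun m => M (Function.update m j i) ω with hf
    have hfs : Submartingale f (slice F n j) P :=
      submartingale_sup' _ _ fun m hm => hM m (mem_face.1 hm).1 j
    have hfb : ∀ i, Bdd (f i) := fun i => Bdd.sup' _ _ fun m _ => hb _
    have h1 := integral_exp_runMax_le hfs hfb (n j)
    have hsm : ∀ K : Finset (Fin d), Measurable fun ω =>
        (face K n).sup' (face_nonempty K n) fun m => M m ω := fun K =>
      by
      convert Finset.measurable_sup' (face_nonempty K n) fun m _ => hm m using 1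
      exact funext fun ω => (Finset.sup'_apply _ _ ω).symm
    have h2 : ∫ ω, Real.exp ((face (insert j J) n).sup' (face_nonempty _ n) fun m => M m ω) ∂P ≤
        ∫ ω, Real.exp (runMax f (n j) ω) ∂P := by
      refine integral_mono ((Bdd.sup' _ _ fun m _ => hb m).exp.integrable (hsm _).exp)
        ((bdd_runMax hfb _).exp.integrable
          ((measurable_runMax hfs _).mono ((slice F n j).le _) le_rfl).exp) fun ω => ?_
      exact Real.exp_le_exp.2 (sup'_face_insert_le ω)
    have h3 : f (n j) = fun ω => (face J n).sup' (face_nonempty J n) fun m => M m ω :=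
      funext fun ω => sup'_face_update hj ω
    rw [h3] at h1
    refine h2.trans (h1.trans ?_)
    rw [Finset.card_insert_of_notMem hj, Nat.cast_add, Nat.cast_one, add_comm, Real.exp_add,
      mul_assoc]
    exact mul_le_mul_of_nonneg_left ih (Real.exp_pos _).le

/-- The exponential maximal inequality for a bounded field which is a submartingale in each
coordinate. -/
theorem measureReal_le_sup'_Iic_le (hd : 1 ≤ d)
    (hM : ∀ m ≤ n, ∀ j, Submartingale (fun i => M (Function.update m j i)) (slice F n j) P)
    (hb : ∀ m, Bdd (M m)) (hm : ∀ m, Measurable (M m)) (a : ℝ) :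
    P.real {ω | ∃ m ≤ n, a ≤ M m ω} ≤
      Real.exp ((d : ℝ) - 1) * (Real.exp (-a) * ∫ ω, Real.exp (M n ω) ∂P) := by
  classical
  set j : Fin d := ⟨0, hd⟩
  -- One coordinate is kept for the tail bound, which carries no factor `e`; the other `d - 1` go
  -- through the exponential bound.
  set J : Finset (Fin d) := Finset.univ.erase j with hJ
  have hcard : (J.card : ℝ) = (d : ℝ) - 1 := by
    rw [hJ, Finset.card_erase_of_mem (Finset.mem_univ _), Finset.card_univ, Fintype.card_fin,
      Nat.cast_sub hd, Nat.cast_one]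
  set f : ℕ → Ω → ℝ := fun i ω => (face J n).sup' (face_nonempty J n)
      fun m => M (Function.update m j i) ω with hf
  have hfs : Submartingale f (slice F n j) P :=
    submartingale_sup' _ _ fun m hm => hM m (mem_face.1 hm).1 j
  have hfb : ∀ i, Bdd (f i) := fun i => Bdd.sup' _ _ fun m _ => hb _
  have h1 := measureReal_le_runMax_le hfs hfb a (n j)
  have h3 : f (n j) = fun ω => (face J n).sup' (face_nonempty J n) fun m => M m ω :=
    funext fun ω => sup'_face_update (by simp [hJ]) ω
  rw [h3] at h1
  have h4 := integral_exp_sup'_face_le hM hb hm J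
  rw [hcard] at h4
  have h5 : {ω | ∃ m ≤ n, a ≤ M m ω} ⊆ {ω | a ≤ runMax f (n j) ω} := by
    rintro ω ⟨m, hmn, hmω⟩
    refine hmω.trans (le_trans ?_ (sup'_face_insert_le (J := J) (j := j) ω))
    have hm' : m ∈ face (insert j J) n := by
      refine mem_face.2 ⟨hmn, fun i hi => absurd ?_ hi⟩
      rw [hJ, Finset.insert_erase (Finset.mem_univ _)]
      exact Finset.mem_univ _
    exact Finset.le_sup' (fun m => M m ω) hm'
  refine (measureReal_mono h5).trans (h1.trans ?_)
  refine (mul_le_mul_of_nonneg_left h4 (Real.exp_pos (-a)).le).trans (le_of_eq ?_)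
  ring

end BoxMax

/-! ### Rectangular sums as coordinatewise martingales -/

section Sums

variable {d : ℕ} {Ω : Type*} {mΩ : MeasurableSpace Ω} {P : Measure Ω} [IsProbabilityMeasure P]
  {F : Filtration (Fin d → ℕ) mΩ}

/-- Under (F4), the sums of a field of bounded centred variables form a martingale in each
coordinate. -/
theorem martingale_sum_Icc (hF4 : CondF4 P F) {ξ : (Fin d → ℕ) → Ω → ℝ}
    (hξ : ∀ k, Measurable[F k] (ξ k)) (hξb : ∀ k, Bdd (ξ k))
    (h0 : ∀ k, 1 ≤ k → P[ξ k | sigmaTildePred F k] =ᵐ[P] 0) {m n : Fin d → ℕ} (hmn : m ≤ n)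
    (j : Fin d) :
    Martingale (fun i ω => ∑ k ∈ Finset.Icc 1 (Function.update m j i), ξ k ω)
      (slice F n j) P := by
  have hξi : ∀ k, Integrable (ξ k) P := fun k =>
    (hξb k).integrable ((hξ k).mono (F.le k) le_rfl)
  -- All `m ≤ n` use the same filtration through `n`, so that maxima over such `m` remain
  -- submartingales for it.
  have hle : ∀ i, Function.update m j i ≤ Function.update n j i := fun i =>
    update_le_update_iff.2 ⟨le_rfl, fun i _ => hmn i⟩
  refine martingale_of_condExp_sub_eq_zero_nat (fun i => Measurable.stronglyMeasurable ?_)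
    (fun i => integrable_finsetSum _ fun k _ => hξi k) fun i => ?_
  · refine Finset.measurable_fun_sum _ fun k hk => (hξ k).mono ?_ le_rfl
    exact F.mono ((Finset.mem_Icc.1 hk).2.trans (hle i))
  · have hsub : Finset.Icc 1 (Function.update m j i) ⊆
        Finset.Icc 1 (Function.update m j (i + 1)) :=
      Finset.Icc_subset_Icc_right (Function.update_mono (Nat.le_succ i))
    set T := Finset.Icc 1 (Function.update m j (i + 1)) \ Finset.Icc 1 (Function.update m j i)
    have hT : ((fun ω => ∑ k ∈ Finset.Icc 1 (Function.update m j (i + 1)), ξ k ω) -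
        fun ω => ∑ k ∈ Finset.Icc 1 (Function.update m j i), ξ k ω) = ∑ k ∈ T, ξ k := by
      ext ω
      simp only [Pi.sub_apply, Finset.sum_apply]
      rw [← Finset.sum_sdiff hsub, add_sub_cancel_right]
    rw [hT]
    refine (condExp_finsetSum (fun k _ => hξi k) _).trans ?_
    have hz : ∀ k ∈ T, P[ξ k | slice F n j i] =ᵐ[P] 0 := by
      intro k hk
      obtain ⟨hk1, hk2⟩ := Finset.mem_sdiff.1 hk
      obtain ⟨h1k, hki⟩ := Finset.mem_Icc.1 hk1
      -- An index gained in passing from `i` to `i + 1` exceeds `i` in coordinate `j`, so (F4)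
      -- centres its term given the slice at `i`.
      have hlt : i < k j := by
        by_contra hcon
        refine hk2 (Finset.mem_Icc.2 ⟨h1k, fun l => ?_⟩)
        rcases eq_or_ne l j with rfl | hl
        · simpa using hcon
        · simpa [hl] using hki l
      exact condExp_eq_zero_of_lt hF4 (hξ k) (hξb k) (h0 k h1k) (j := j) (by simpa using hlt)
    have hz' := (Finset.eventually_all T).2 hz
    filter_upwards [hz'] with ω hω
    rw [Finset.sum_apply]
    exact Finset.sum_eq_zero fun k hk => hω k hk

end Sums

/-! ### Elementary exponential inequalities -/

section Exponential

/-- Compare the power series term by term: `u^{n+2} ≤ u² v^n`. -/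
theorem exp_sub_one_sub_le {u v : ℝ} (hv : 0 < v) (huv : |u| ≤ v) :
    Real.exp u - 1 - u ≤ (u / v) ^ 2 * (Real.exp v - 1 - v) := by
  have hs : ∀ w : ℝ, HasSum (fun n : ℕ => w ^ (n + 2) / (n + 2).factorial)
      (Real.exp w - 1 - w) := by
    intro w
    have h := NormedSpace.expSeries_div_hasSum_exp (𝔸 := ℝ) w
    rw [← Real.exp_eq_exp_ℝ, ← hasSum_nat_add_iff' 2] at h
    simpa [Finset.sum_range_succ, sub_sub] using h
  refine hasSum_le (fun n => ?_) (hs u) ((hs v).mul_left ((u / v) ^ 2))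
  have h1 : u ^ n ≤ v ^ n := (le_abs_self _).trans
    ((abs_pow u n).le.trans (pow_le_pow_left₀ (abs_nonneg u) huv n))
  have h2 : (u / v) ^ 2 * (v ^ (n + 2) / (n + 2).factorial) =
      u ^ 2 * v ^ n / (n + 2).factorial := by
    rw [div_pow, pow_add]
    field_simp
  rw [h2, pow_add, mul_comm (u ^ n)]
  gcongr

theorem exp_mul_le_one_add {h t y r : ℝ} (hh : 0 < h) (hy : 0 < y) (hr0 : 0 ≤ r) (hr : r ≤ 2)
    (ht : |t| ≤ y) :
    Real.exp (h * t) ≤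
      1 + h * t + (Real.exp (h * y) - 1 - h * y) / y ^ r * |t| ^ r := by
  have hv : 0 < h * y := mul_pos hh hy
  have h1 := exp_sub_one_sub_le (u := h * t) hv
    (by rw [abs_mul, abs_of_pos hh]; exact mul_le_mul_of_nonneg_left ht hh.le)
  -- Since `|t|/y ≤ 1` and `r ≤ 2`, lowering the exponent from 2 to `r` increases the power.
  have h2 : (h * t / (h * y)) ^ 2 ≤ |t| ^ r / y ^ r := by
    rw [mul_div_mul_left _ _ hh.ne', ← Real.div_rpow (abs_nonneg t) hy.le, div_pow, ← sq_abs t,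
      ← div_pow, ← Real.rpow_natCast]
    exact Real.rpow_le_rpow_of_exponent_ge' (by positivity) ((div_le_one hy).2 ht) hr0
      (by simpa using hr)
  have h3 : 0 ≤ Real.exp (h * y) - 1 - h * y := by linarith [Real.add_one_le_exp (h * y)]
  have h4 := h1.trans (mul_le_mul_of_nonneg_right h2 h3)
  have h5 : |t| ^ r / y ^ r * (Real.exp (h * y) - 1 - h * y) =
      (Real.exp (h * y) - 1 - h * y) / y ^ r * |t| ^ r := by ring
  linarith

end Exponential

/-! ### The Fuk–Nagaev inequality for bounded fields -/

section FukNagaev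

variable {d : ℕ} {Ω : Type*} {mΩ : MeasurableSpace Ω} {P : Measure Ω} [IsProbabilityMeasure P]
  {F : Filtration (Fin d → ℕ) mΩ}

/-- The bound on the conditional exponential moment of a centred bounded variable. -/
theorem condExp_exp_sub_le {m : MeasurableSpace Ω} (hm : m ≤ mΩ) {η V : Ω → ℝ} {h y r β : ℝ}
    (hh : 0 < h) (hy : 0 < y) (hr0 : 0 ≤ r) (hr : r ≤ 2) (hη : Measurable[mΩ] η)
    (hηy : ∀ ω, |η ω| ≤ y) (hV : Measurable[m] V) (hVb : Bdd V) (hVη : V =ᵐ[P] P[η | m])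
    (hβ : P[fun ω => |η ω| ^ r | m] ≤ᵐ[P] fun _ => β) :
    P[fun ω => Real.exp (h * (η ω - V ω)) | m] ≤ᵐ[P]
      fun _ => Real.exp ((Real.exp (h * y) - 1 - h * y) / y ^ r * β) := by
  set g : ℝ := (Real.exp (h * y) - 1 - h * y) / y ^ r with hg
  have hg0 : 0 ≤ g := div_nonneg (by linarith [Real.add_one_le_exp (h * y)])
    (Real.rpow_nonneg hy.le r)
  have hηb : Bdd η := ⟨y, hηy⟩
  have hηi : Integrable η P := hηb.integrable hη
  have hpb : Bdd fun ω => |η ω| ^ r := ⟨y ^ r, fun ω => by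
    rw [abs_of_nonneg (Real.rpow_nonneg (abs_nonneg _) r)]
    exact Real.rpow_le_rpow (abs_nonneg _) (hηy ω) hr0⟩
  have hpi : Integrable (fun ω => |η ω| ^ r) P :=
    hpb.integrable ((measurable_norm.comp hη).pow_const r)
  have heb : Bdd fun ω => Real.exp (h * η ω) := ((Bdd.const h).mul hηb).exp
  have hei : Integrable (fun ω => Real.exp (h * η ω)) P :=
    heb.integrable (hη.const_mul h).exp
  have hWm : Measurable[m] fun ω => Real.exp (-(h * V ω)) := (hV.const_mul h).neg.exp
  have hWb : Bdd fun ω => Real.exp (-(h * V ω)) := ((Bdd.const h).mul hVb).neg.exp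
  obtain ⟨C, hC⟩ := hWb
  -- The factor `e^{-hV}` is `m`-measurable and comes out; it later cancels the `hV` in `1 + hV + gβ
  -- ≤ e^{hV + gβ}`.
  have h1 := condExp_stronglyMeasurable_mul_of_bound (μ := P) hm hWm.stronglyMeasurable hei C
    (.of_forall hC)
  have h2 : ((fun ω => Real.exp (-(h * V ω))) * fun ω => Real.exp (h * η ω)) =
      fun ω => Real.exp (h * (η ω - V ω)) := by
    ext ω
    simp only [Pi.mul_apply]
    rw [← Real.exp_add]
    ring_nf
  rw [h2] at h1
  have h3 : P[fun ω => Real.exp (h * η ω) | m] ≤ᵐ[P]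
      P[(fun _ => (1 : ℝ)) + h • η + g • fun ω => |η ω| ^ r | m] := by
    refine condExp_mono hei (((integrable_const _).add (hηi.smul h)).add (hpi.smul g))
      (.of_forall fun ω => ?_)
    exact exp_mul_le_one_add hh hy hr0 hr (hηy ω)
  have h4 := condExp_add (μ := P) ((integrable_const (1 : ℝ)).add (hηi.smul h)) (hpi.smul g) m
  have h5 := condExp_add (μ := P) (integrable_const (1 : ℝ)) (hηi.smul h) m
  have h6 := condExp_smul (μ := P) h η m
  have h7 := condExp_smul (μ := P) g (fun ω => |η ω| ^ r) m
  rw [condExp_const hm] at h5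
  filter_upwards [h1, h3, h4, h5, h6, h7, hVη, hβ] with ω e1 e3 e4 e5 e6 e7 e8 e9
  rw [e1, Pi.mul_apply]
  rw [e4, Pi.add_apply, e5, Pi.add_apply, e6, e7, Pi.smul_apply, Pi.smul_apply, ← e8,
    smul_eq_mul, smul_eq_mul] at e3
  have e10 : (P[fun ω => Real.exp (h * η ω) | m]) ω ≤ Real.exp (h * V ω + g * β) := by
    have := Real.add_one_le_exp (h * V ω + g * β)
    have := mul_le_mul_of_nonneg_left e9 hg0
    linarith
  refine (mul_le_mul_of_nonneg_left e10 (Real.exp_pos _).le).trans (le_of_eq ?_)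
  rw [← Real.exp_add]
  ring_nf

theorem boxSum_mono {a : (Fin d → ℕ) → ℝ} (ha : ∀ k, 0 ≤ a k) {m n : Fin d → ℕ} (h : m ≤ n) :
    boxSum a m ≤ boxSum a n :=
  Finset.sum_le_sum_of_subset_of_nonneg (Finset.Icc_subset_Icc_right h) fun k _ _ => ha k

/-- The exponential inequality for a bounded field, with a free parameter `h`. -/
theorem measureReal_le_sum_Icc_le (hd : 1 ≤ d) (hF4 : CondF4 P F) (hF5 : 2 < d → CondF5 P F)
    {η : (Fin d → ℕ) → Ω → ℝ} {x y r h : ℝ} (hh : 0 < h) (hy : 0 < y) (hr0 : 0 ≤ r) (hr : r ≤ 2)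
    (hη : ∀ k, Measurable[F k] (η k)) (hηy : ∀ k ω, |η k ω| ≤ y)
    {δ β : (Fin d → ℕ) → ℝ} (hδ0 : ∀ k, 0 ≤ δ k)
    (hδ : ∀ k, 1 ≤ k → P[η k | sigmaTildePred F k] ≤ᵐ[P] fun _ => δ k)
    (hβ : ∀ k, 1 ≤ k → P[fun ω => |η k ω| ^ r | sigmaTildePred F k] ≤ᵐ[P] fun _ => β k)
    (n : Fin d → ℕ) :
    P.real {ω | ∃ m ≤ n, x ≤ ∑ k ∈ Finset.Icc 1 m, η k ω} ≤
      Real.exp ((d : ℝ) - 1) * Real.exp (-(h * (x - boxSum δ n)) +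
        (Real.exp (h * y) - 1 - h * y) / y ^ r * boxSum β n) := by
  set g : ℝ := (Real.exp (h * y) - 1 - h * y) / y ^ r with hg
  have hηm : ∀ k, Measurable (η k) := fun k => (hη k).mono (F.le k) le_rfl
  have hηb : ∀ k, Bdd (η k) := fun k => ⟨y, hηy k⟩
  choose V hVm hVb hV using fun k =>
    exists_bdd_condExp (P := P) (m := sigmaTildePred F k) (hηb k)
  have hVi : ∀ k, Integrable (V k) P := fun k =>
    (hVb k).integrable ((hVm k).mono (sigmaTildePred_le F k) le_rfl)
  set ξ : (Fin d → ℕ) → Ω → ℝ := fun k ω => h * (η k ω - V k ω) with hξ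
  have hξm : ∀ k, Measurable[F k] (ξ k) := fun k =>
    ((hη k).sub ((hVm k).mono inf_le_right le_rfl)).const_mul h
  have hξm' : ∀ k, Measurable (ξ k) := fun k => (hξm k).mono (F.le k) le_rfl
  have hξb : ∀ k, Bdd (ξ k) := fun k => (Bdd.const h).mul ((hηb k).sub (hVb k))
  have hξ0 : ∀ k, 1 ≤ k → P[ξ k | sigmaTildePred F k] =ᵐ[P] 0 := by
    intro k _
    have e1 := condExp_smul (μ := P) h (η k - V k) (sigmaTildePred F k)
    have e2 := condExp_sub (μ := P) ((hηb k).integrable (hηm k)) (hVi k) (sigmaTildePred F k)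
    rw [condExp_of_stronglyMeasurable (sigmaTildePred_le F k) (hVm k).stronglyMeasurable
      (hVi k)] at e2
    filter_upwards [e1, e2, hV k] with ω e1 e2 e3
    refine e1.trans ?_
    simp [e2, e3]
  set M : (Fin d → ℕ) → Ω → ℝ := fun m ω => ∑ k ∈ Finset.Icc 1 m, ξ k ω with hM
  have hMb : ∀ m, Bdd (M m) := fun m => Bdd.sum _ fun k _ => hξb k
  have hMm : ∀ m, Measurable (M m) := fun m => Finset.measurable_fun_sum _ fun k _ => hξm' k
  have h1 := measureReal_le_sup'_Iic_le hd (P := P) (F := F) (n := n)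
    (fun m hm j => (martingale_sum_Icc hF4 hξm hξb hξ0 hm j).submartingale) hMb hMm
    (h * (x - boxSum δ n))
  have h2 : ∫ ω, Real.exp (M n ω) ∂P ≤ Real.exp (g * boxSum β n) := by
    have e1 := integral_prod_le hd hF4 hF5 n (Z := fun k ω => Real.exp (ξ k ω))
      (c := fun k => Real.exp (g * β k)) (fun k => (hξm k).exp) (fun k => (hξb k).exp)
      (fun k ω => (Real.exp_pos _).le) (fun k => (Real.exp_pos _).le)
      (fun k hk => condExp_exp_sub_le (sigmaTildePred_le F k) hh hy hr0 hr (hηm k) (hηy k)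
        (hVm k) (hVb k) (hV k) (hβ k hk)) (Finset.Icc 1 n) subset_rfl
    simp only [← Real.exp_sum, ← Finset.mul_sum] at e1
    exact e1
  have h3 : ∀ᵐ ω ∂P, ∀ k, 1 ≤ k → V k ω ≤ δ k := by
    refine ae_all_iff.2 fun k => ?_
    by_cases hk : 1 ≤ k
    · filter_upwards [hV k, hδ k hk] with ω e1 e2 _
      exact e1.le.trans e2
    · exact .of_forall fun ω hk' => absurd hk' hk
  -- The partial sums of `V` are at most `D_m ≤ D_n`, as `δ ≥ 0`, so one threshold serves all `m ≤
  -- n`.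
  have h4 : P.real {ω | ∃ m ≤ n, x ≤ ∑ k ∈ Finset.Icc 1 m, η k ω} ≤
      P.real {ω | ∃ m ≤ n, h * (x - boxSum δ n) ≤ M m ω} := by
    refine ENNReal.toReal_mono (measure_ne_top _ _) (measure_mono_ae ?_)
    filter_upwards [h3] with ω e1
    rintro ⟨m, hmn, hm⟩
    refine ⟨m, hmn, ?_⟩
    have e2 : ∑ k ∈ Finset.Icc 1 m, V k ω ≤ boxSum δ n :=
      (Finset.sum_le_sum fun k hk => e1 k (Finset.mem_Icc.1 hk).1).trans (boxSum_mono hδ0 hmn)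
    simp only [hM, hξ, ← Finset.mul_sum, Finset.sum_sub_distrib]
    exact mul_le_mul_of_nonneg_left (by linarith) hh.le
  refine h4.trans (h1.trans (mul_le_mul_of_nonneg_left ?_ (Real.exp_pos _).le))
  rw [Real.exp_add]
  exact mul_le_mul_of_nonneg_left h2 (Real.exp_pos _).le

/-- The exponential inequality for a bounded field, with the parameter optimised. -/
theorem measureReal_le_sum_Icc_le_log (hd : 1 ≤ d) (hF4 : CondF4 P F)
    (hF5 : 2 < d → CondF5 P F) {η : (Fin d → ℕ) → Ω → ℝ} {x y r : ℝ} (hx : 0 < x) (hy : 0 < y)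
    (hr0 : 0 ≤ r) (hr : r ≤ 2)
    (hη : ∀ k, Measurable[F k] (η k)) (hηy : ∀ k ω, |η k ω| ≤ y)
    {δ β : (Fin d → ℕ) → ℝ} (hδ0 : ∀ k, 0 ≤ δ k) (hβ0 : ∀ k, 0 < β k)
    (hδ : ∀ k, 1 ≤ k → P[η k | sigmaTildePred F k] ≤ᵐ[P] fun _ => δ k)
    (hβ : ∀ k, 1 ≤ k → P[fun ω => |η k ω| ^ r | sigmaTildePred F k] ≤ᵐ[P] fun _ => β k)
    (n : Fin d → ℕ) :
    P.real {ω | ∃ m ≤ n, x ≤ ∑ k ∈ Finset.Icc 1 m, η k ω} ≤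
      Real.exp ((d : ℝ) - 1) * Real.exp (x / y -
        ((x - boxSum δ n) / y + boxSum β n / y ^ r) *
          Real.log (x * y ^ (r - 1) / boxSum β n + 1)) := by
  by_cases hn : 1 ≤ n
  · have hB : 0 < boxSum β n :=
      Finset.sum_pos (fun k _ => hβ0 k) ⟨1, Finset.mem_Icc.2 ⟨le_rfl, hn⟩⟩
    set B := boxSum β n
    have hq : 0 < x * y ^ (r - 1) / B := by positivity
    set q := x * y ^ (r - 1) / B with hqdef
    have hL : 0 < Real.log (q + 1) := Real.log_pos (by linarith)
    set L := Real.log (q + 1) with hLdef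
    -- The parameter `h = L / y` solves `e^{hy} = 1 + q`; it minimises `-hx + (e^{hy} - 1 - hy) B /
    -- y^r`, the exponent without its `D_n` term.
    have h1 := measureReal_le_sum_Icc_le hd hF4 hF5 (x := x) (div_pos hL hy) hy hr0 hr hη hηy hδ0
      hδ hβ n
    refine h1.trans (le_of_eq ?_)
    congr 2
    have h2 : L / y * y = L := div_mul_cancel₀ _ hy.ne'
    have h3 : Real.exp L = q + 1 := Real.exp_log (by linarith)
    have h4 : q * B = x * y ^ (r - 1) := div_mul_cancel₀ _ hB.ne'
    have h5 : q / y ^ r * B = x / y := by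
      rw [div_mul_eq_mul_div, h4, Real.rpow_sub_one hy.ne']
      have := Real.rpow_pos_of_pos hy r
      field_simp
    rw [h2, h3]
    have h6 : (q + 1 - 1 - L) / y ^ r * B = q / y ^ r * B - L * (B / y ^ r) := by ring
    change _ + (q + 1 - 1 - L) / y ^ r * B = _
    rw [h6, h5]
    ring
  -- If `n` has a zero coordinate then `B = 0`. Division by zero gives 0, the logarithm vanishes,
  -- and the bound `e^{d-1} e^{x/y} ≥ 1` is trivial.
  · have hempty : Finset.Icc 1 n = ∅ := Finset.Icc_eq_empty hn
    have hB : boxSum β n = 0 := by simp [boxSum, hempty]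
    rw [hB]
    simp only [div_zero, zero_add, Real.log_one, mul_zero, sub_zero]
    refine measureReal_le_one.trans ?_
    have hd' : (1 : ℝ) ≤ d := by exact_mod_cast hd
    exact one_le_mul_of_one_le_of_one_le (Real.one_le_exp (by linarith))
      (Real.one_le_exp (by positivity))

end FukNagaev

/-! ### Truncation and passage to the original field -/

section Truncation

variable {d : ℕ} {Ω : Type*} {mΩ : MeasurableSpace Ω} {F : Filtration (Fin d → ℕ) mΩ}
  {X : (Fin d → ℕ) → Ω → ℝ}

/-- The truncation of a variable at level `y`. -/
noncomputable def trunc (y : ℝ) (f : Ω → ℝ) : Ω → ℝ := {ω | |f ω| ≤ y}.indicator f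

theorem measurable_trunc {m : MeasurableSpace Ω} {f : Ω → ℝ} (y : ℝ) (hf : Measurable[m] f) :
    Measurable[m] (trunc y f) :=
  hf.indicator ((measurable_norm.comp hf) measurableSet_Iic)

theorem abs_trunc_le {y : ℝ} (hy : 0 ≤ y) (f : Ω → ℝ) (ω : Ω) : |trunc y f ω| ≤ y := by
  by_cases h : |f ω| ≤ y <;> simp [trunc, h, hy]

/-- The two sides differ only where `f > y`, where the right side is positive, and possibly where `f
= -y`, where the left side is `-y ≤ 0`. This turns the hypothesis on `X I[X > -y]` into a bound on
the conditional mean of the truncation. -/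
theorem trunc_le_indicator {y : ℝ} (hy : 0 ≤ y) (f : Ω → ℝ) (ω : Ω) :
    trunc y f ω ≤ {ω | f ω > -y}.indicator f ω := by
  by_cases h3 : f ω > -y
  · rw [Set.indicator_of_mem (s := {ω | f ω > -y}) h3]
    by_cases h2 : |f ω| ≤ y
    · simp [trunc, h2]
    · rw [trunc, Set.indicator_of_notMem (s := {ω | |f ω| ≤ y}) h2]
      by_contra h4
      exact h2 (abs_le.2 ⟨h3.le, by linarith⟩)
  · rw [Set.indicator_of_notMem (s := {ω | f ω > -y}) h3]
    by_cases h2 : |f ω| ≤ y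
    · rw [trunc, Set.indicator_of_mem (s := {ω | |f ω| ≤ y}) h2]
      linarith
    · simp [trunc, h2]

theorem le_trunc_of_le {y : ℝ} {f : Ω → ℝ} {ω : Ω} (h : f ω ≤ y) :
    f ω ≤ trunc y f ω := by
  by_cases h2 : |f ω| ≤ y
  · simp [trunc, h2]
  · rw [trunc, Set.indicator_of_notMem (s := {ω | |f ω| ≤ y}) h2]
    by_contra h4
    exact h2 (abs_le.2 ⟨by linarith, h⟩)

theorem abs_trunc_rpow {r : ℝ} (hr : 0 < r) (y : ℝ) (f : Ω → ℝ) :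
    (fun ω => |trunc y f ω| ^ r) = {ω | |f ω| ≤ y}.indicator fun ω => |f ω| ^ r := by
  ext ω
  by_cases h : |f ω| ≤ y <;> simp [trunc, h, Real.zero_rpow hr.ne']

theorem partialSum_eq_sum_Icc (hX1 : CondX1 X) (n : Fin d → ℕ) (ω : Ω) :
    partialSum X n ω = ∑ k ∈ Finset.Icc 1 n, X k ω := by
  refine (Finset.sum_subset (fun k hk => Finset.mem_Iic.2 (Finset.mem_Icc.1 hk).2)
    fun k hk hk' => ?_).symm
  have h1 : ¬ 1 ≤ k := fun h => hk' (Finset.mem_Icc.2 ⟨h, Finset.mem_Iic.1 hk⟩)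
  obtain ⟨j, hj⟩ : ∃ j, k j < 1 := by simpa [Pi.le_def] using h1
  rw [hX1 k (Finset.prod_eq_zero (Finset.mem_univ j) (by omega))]
  rfl

theorem le_maxUpTo_iff {Y : (Fin d → ℕ) → Ω → ℝ} {n : Fin d → ℕ} {ω : Ω} {a : ℝ} :
    a ≤ maxUpTo Y n ω ↔ ∃ m ≤ n, a ≤ Y m ω := by
  simp [maxUpTo, Finset.le_sup'_iff]

end Truncation

end RandomField

/-! ### The two inequalities -/

theorem mainTheorem3 {Ω : Type*} {mΩ : MeasurableSpace Ω} (P : Measure Ω) [IsProbabilityMeasure P]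
    (d : ℕ) (hd : 1 ≤ d) (F : Filtration (Fin d → ℕ) mΩ)
    (hF3 : RandomField.CondF3 P F) (hF4 : RandomField.CondF4 P F)
    (hF5 : 2 < d → RandomField.CondF5 P F)
    (X : (Fin d → ℕ) → Ω → ℝ) (hint : ∀ k, Integrable (X k) P)
    (hX1 : RandomField.CondX1 X) (hX2 : RandomField.CondX2 F X)
    (x y r : ℝ) (hx : 0 < x) (hy : 0 < y) (hr1 : 1 ≤ r) (hr2 : r ≤ 2) :
    (∀ b δ : (Fin d → ℕ) → ℝ, (∀ k, 0 < b k) → (∀ k, 0 < δ k) →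
      RandomField.CondX3 P F X →
      (∀ k : Fin d → ℕ, 1 ≤ k →
        P[{ω | |X k ω| ≤ y}.indicator (fun ω => |X k ω| ^ r) | RandomField.sigmaTildePred F k]
          ≤ᵐ[P] fun _ => b k ^ r) →
      (∀ k : Fin d → ℕ, 1 ≤ k →
        P[{ω | X k ω > -y}.indicator (X k) | RandomField.sigmaTildePred F k]
          ≤ᵐ[P] fun _ => δ k) →
      ∀ n : Fin d → ℕ,
        P.real {ω | RandomField.maxUpTo (RandomField.partialSum X) n ω ≥ x} ≤
          P.real {ω | RandomField.maxUpTo X n ω ≥ y} +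
          Real.exp ((d : ℝ) - 1) *
            Real.exp (x / y -
              ((x - RandomField.boxSum δ n) / y
                + RandomField.boxSum (fun k => b k ^ r) n / y ^ r) *
              Real.log (x * y ^ (r - 1) / RandomField.boxSum (fun k => b k ^ r) n + 1))) ∧
    (∀ m l : (Fin d → ℕ) → ℝ, (∀ k, 0 < m k) → (∀ k, 0 < l k) →
      RandomField.CondX3' P F X →
      (∀ k : Fin d → ℕ, 1 ≤ k →
        Integrable (fun ω => |X k ω| ^ r) P ∧
        P[fun ω => |X k ω| ^ r | RandomField.sigmaTildePred F k] ≤ᵐ[P] fun _ => m k ^ r) →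
      (∀ k : Fin d → ℕ, 1 ≤ k →
        P[{ω | |X k ω| > y}.indicator (fun ω => |X k ω|) | RandomField.sigmaTildePred F k]
          ≤ᵐ[P] fun _ => l k) →
      ∀ n : Fin d → ℕ,
        P.real {ω | RandomField.maxUpTo (fun k ω => |RandomField.partialSum X k ω|) n ω ≥ x} ≤
          P.real {ω | RandomField.maxUpTo (fun k ω => |X k ω|) n ω ≥ y} +
          2 * Real.exp ((d : ℝ) - 1) *
            Real.exp (x / y -
              ((x - RandomField.boxSum l n) / y
                + RandomField.boxSum (fun k => m k ^ r) n / y ^ r) *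
              Real.log (x * y ^ (r - 1) / RandomField.boxSum (fun k => m k ^ r) n + 1))) := by
  open RandomField in
  have hr0 : 0 < r := by linarith
  have hXm : ∀ k, Measurable (X k) := fun k => (hX2 k).mono (F.le k) le_rfl
  have hTm : ∀ k, Measurable[F k] (trunc y (X k)) := fun k => measurable_trunc y (hX2 k)
  have hTi : ∀ k, Integrable (trunc y (X k)) P := fun k =>
    (hint k).indicator ((measurable_norm.comp (hXm k)) measurableSet_Iic)
  have hmsle : ∀ k, MeasurableSet {ω | |X k ω| ≤ y} := fun k =>
    (measurable_norm.comp (hXm k)) measurableSet_Iic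
  have hmsgt : ∀ k, MeasurableSet {ω | |X k ω| > y} := fun k =>
    (measurable_norm.comp (hXm k)) measurableSet_Ioi
  refine ⟨fun b δ hb hδ _ hbr hδd n => ?_, fun m l hm hl hX3 hmr hld n => ?_⟩
  · have h1 := measureReal_le_sum_Icc_le_log (P := P) hd hF4 hF5 hx hy hr0.le hr2 hTm
      (fun k => abs_trunc_le hy.le (X k)) (δ := δ) (β := fun k => b k ^ r)
      (fun k => (hδ k).le) (fun k => Real.rpow_pos_of_pos (hb k) r)
      (fun k hk => by
        exact (condExp_mono (hTi k) ((hint k).indicator ((hXm k) measurableSet_Ioi))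
          (.of_forall fun ω => trunc_le_indicator hy.le (X k) ω)).trans (hδd k hk))
      (fun k hk => by rw [abs_trunc_rpow hr0]; exact hbr k hk) n
    refine le_trans ?_ (add_le_add le_rfl h1)
    refine le_trans (measureReal_mono fun ω hω => ?_) (measureReal_union_le _ _)
    -- If no `X_k` with `k ≤ n` reaches `y`, truncation can only raise the terms, by discarding
    -- values below `-y`, so the truncated sum also reaches `x`.
    by_cases hy' : y ≤ maxUpTo X n ω
    · exact Or.inl hy'
    · refine Or.inr ?_
      obtain ⟨j, hjn, hj⟩ := le_maxUpTo_iff.1 hω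
      refine ⟨j, hjn, hj.trans ?_⟩
      rw [partialSum_eq_sum_Icc hX1]
      refine Finset.sum_le_sum fun k hk => ?_
      have hky : X k ω < y := by
        by_contra hcon
        exact hy' (le_maxUpTo_iff.2 ⟨k, (Finset.mem_Icc.1 hk).2.trans hjn, not_lt.1 hcon⟩)
      exact le_trunc_of_le hky.le
  · have hr' : ∀ k, 1 ≤ k →
        P[fun ω => |trunc y (X k) ω| ^ r | sigmaTildePred F k] ≤ᵐ[P] fun _ => m k ^ r := by
      intro k hk
      rw [abs_trunc_rpow hr0]
      refine Filter.EventuallyLE.trans (condExp_mono ((hmr k hk).1.indicator (hmsle k))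
        (hmr k hk).1 (.of_forall fun ω => ?_)) (hmr k hk).2
      exact Set.indicator_le_self' (fun _ _ => Real.rpow_nonneg (abs_nonneg _) r) ω
    -- As `X_k` is centred given F-tilde, the conditional mean of its truncation is minus that of
    -- the discarded part `R`, which is at most `l k` in absolute value. The two-sided bound serves
    -- both signs of the field.
    have hc : ∀ k, 1 ≤ k → ∀ᵐ ω ∂P, |(P[trunc y (X k) | sigmaTildePred F k]) ω| ≤ l k := by
      intro k hk
      set R : Ω → ℝ := {ω | |X k ω| > y}.indicator (X k) with hR
      have hRi : Integrable R P := (hint k).indicator (hmsgt k)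
      have hdec : trunc y (X k) = X k - R := by
        ext ω
        by_cases h2 : |X k ω| ≤ y
        · simp [trunc, hR, h2]
        · simp [trunc, hR, h2, not_le.1 h2]
      have e1 := condExp_sub (μ := P) (hint k) hRi (sigmaTildePred F k)
      rw [← hdec] at e1
      have hAi : Integrable ({ω | |X k ω| > y}.indicator fun ω => |X k ω|) P :=
        (hint k).abs.indicator (hmsgt k)
      have e2 := condExp_mono (m := sigmaTildePred F k) hRi hAi (.of_forall fun ω =>
        Set.indicator_le_indicator (le_abs_self (X k ω)))
      have e3 := condExp_mono (m := sigmaTildePred F k) hRi.neg hAi (.of_forall fun ω => by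
        by_cases h2 : |X k ω| > y
        · simp [hR, h2, neg_le_abs]
        · simp [hR, h2])
      have e4 := condExp_neg (μ := P) R (sigmaTildePred F k)
      filter_upwards [e1, e2, e3, e4, hX3 k hk, hld k hk] with ω e1 e2 e3 e4 e5 e6
      rw [e4] at e3
      rw [e1, Pi.sub_apply, e5, Pi.zero_apply, zero_sub, abs_neg]
      exact abs_le.2 ⟨by simp only [Pi.neg_apply] at e3; linarith, e2.trans e6⟩
    have h1 := measureReal_le_sum_Icc_le_log (P := P) hd hF4 hF5 hx hy hr0.le hr2 hTm
      (fun k => abs_trunc_le hy.le (X k)) (δ := l) (β := fun k => m k ^ r)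
      (fun k => (hl k).le) (fun k => Real.rpow_pos_of_pos (hm k) r)
      (fun k hk => (hc k hk).mono fun ω h => (abs_le.1 h).2) hr' n
    have h2 := measureReal_le_sum_Icc_le_log (P := P) hd hF4 hF5 hx hy hr0.le hr2
      (η := fun k => -trunc y (X k)) (fun k => (hTm k).neg)
      (fun k ω => by simpa using abs_trunc_le hy.le (X k) ω) (δ := l) (β := fun k => m k ^ r)
      (fun k => (hl k).le) (fun k => Real.rpow_pos_of_pos (hm k) r)
      (fun k hk => by
        filter_upwards [hc k hk, condExp_neg (μ := P) (trunc y (X k)) (sigmaTildePred F k)]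
          with ω h h'
        rw [h', Pi.neg_apply]
        linarith [(abs_le.1 h).1])
      (fun k hk => by simpa using hr' k hk) n
    -- The factor 2 comes from the two one-sided estimates, for the truncated field and for its
    -- negative.
    rw [mul_assoc, two_mul]
    refine le_trans ?_ (add_le_add le_rfl (add_le_add h1 h2))
    refine le_trans (measureReal_mono fun ω hω => ?_) ((measureReal_union_le _ _).trans
      (add_le_add le_rfl (measureReal_union_le _ _)))
    by_cases hy' : y ≤ maxUpTo (fun k ω => |X k ω|) n ω
    · exact Or.inl hy'
    · refine Or.inr ?_
      obtain ⟨j, hjn, hj⟩ := le_maxUpTo_iff.1 hω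
      have hsum : partialSum X j ω = ∑ k ∈ Finset.Icc 1 j, trunc y (X k) ω := by
        rw [partialSum_eq_sum_Icc hX1]
        refine Finset.sum_congr rfl fun k hk => ?_
        have hky : |X k ω| ≤ y := by
          by_contra hcon
          exact hy' (le_maxUpTo_iff.2
            ⟨k, (Finset.mem_Icc.1 hk).2.trans hjn, (not_le.1 hcon).le⟩)
        simp [trunc, hky]
      rw [hsum] at hj
      rcases le_abs.1 hj with h3 | h3
      · exact Or.inl ⟨j, hjn, h3⟩
      · exact Or.inr ⟨j, hjn, by simpa using h3⟩
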